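/- Let $D\subset\mathbb{R}^3$ be a bounded domain (a nonempty, bounded, connected open set; in particular, any bounded topologically trivial domain is allowed) and let $k\ge 2$ be an integer. For nonnegative integers $k_1,k_2,k_3$ let $P_{k_1k_2k_3}(D)$ be the space of real functions on $D$ that are polynomials of degree at most $k_i$ in $x_i$ for $i=1,2,3$, and let $Q_{m}(D;\mathbb{R})=P_{mmm}(D)$. Let $\mathbb{S}$ and $\mathbb{T}$ be the spaces of real symmetric and of real traceless $3\times3$ matrices, and for $u=(u_{ij})_{3\times 3}$ put $$\mathscr{P}_n u=(u_{11},u_{22},u_{33})^{\mathsf T},\qquad \mathscr{P}_t u=(u_{12},u_{13},u_{23})^{\mathsf T}.$$ Define $$RT=\{a\mathbf{x}+b:\ a\in\mathbb{R},\ b\in\mathbb{R}^3\},$$ $$V_{[k]}(D;\mathbb{R}^3)=P_{k,k-1,k-1}(D)\times P_{k-1,k,k-1}(D)\times P_{k-1,k-1,k}(D),$$ $$\begin{aligned}\mathcal U_{[k]}(D;\mathbb{T})=\{u\in H^1(D;\mathbb{T}):\ &\mathscr{P}_n u\in Q_{k-1}(D;\mathbb{R})^3,\\ &\mathscr{P}_t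 u\in P_{k,k-2,k-1}(D)\times P_{k,k-1,k-2}(D)\times P_{k-1,k,k-2}(D),\\ &\mathscr{P}_t(u^{\mathsf T})\in P_{k-2,k,k-1}(D)\times P_{k-2,k-1,k}(D)\times P_{k-1,k-2,k}(D)\},\end{aligned}$$ $$\begin{aligned}\Sigma_{[k]}(D;\mathbb{S})=\{\sigma\in H^1(D;\mathbb{S}):\ &\mathscr{P}_n\sigma\in P_{k,k-2,k-2}(D)\times P_{k-2,k,k-2}(D)\times P_{k-2,k-2,k}(D),\\ &\mathscr{P}_t\sigma\in P_{k-1,k-1,k-2}(D)\times P_{k-1,k-2,k-1}(D)\times P_{k-2,k-1,k-1}(D)\}.\end{aligned}$$ For a vector field $v$ let $(\operatorname{grad}v)_{ij}=\partial_jv_i$; for matrix fields let $\operatorname{curl}$ and the inner $\operatorname{div}$ act by row, and put $\operatorname{dev}A=A-\tfrac13\operatorname{tr}(A)I$, $\operatorname{sym}A=\tfrac12(A+A^{\mathsf T})$. Then $RT\subseteq V_{[k]}(D;\mathbb{R}^3)$, the operators below are linear maps between the indicated spaces, and the sequence $$RT\stackrel{\subseteq}{\longrightarrow}V_{[k]}(D;\mathbb{R}^3)\stackrel{\operatorname{dev}\operatorname{grad}}{\longrightarrow}\mathcal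 U_{[k]}(D;\mathbb{T})\stackrel{\operatorname{sym}\operatorname{curl}}{\longrightarrow}\Sigma_{[k]}(D;\mathbb{S})\stackrel{\operatorname{div}\operatorname{div}}{\longrightarrow}Q_{k-2}(D;\mathbb{R})\longrightarrow 0$$ is exact: the kernel of $\operatorname{dev}\operatorname{grad}$ on $V_{[k]}$ is $RT$, the kernel of $\operatorname{sym}\operatorname{curl}$ on $\mathcal U_{[k]}$ is $\operatorname{dev}\operatorname{grad}V_{[k]}$, the kernel of $\operatorname{div}\operatorname{div}$ on $\Sigma_{[k]}$ is $\operatorname{sym}\operatorname{curl}\,\mathcal U_{[k]}$, and $\operatorname{div}\operatorname{div}$ maps $\Sigma_{[k]}$ onto $Q_{k-2}$. -/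

import Mathlib

open MeasureTheory

open scoped ContDiff

noncomputable section

namespace DivDiv

/-- Three dimensional Euclidean space, carrying Lebesgue measure. -/
abbrev E3 : Type := EuclideanSpace ℝ (Fin 3)

/-- The space `𝕄` of real `3 × 3` matrices. -/
abbrev Mat3 : Type := Matrix (Fin 3) (Fin 3) ℝ

/-- The `i`-th coordinate direction. -/
def dir (i : Fin 3) : E3 := EuclideanSpace.single i 1

variable (D : TopologicalSpace.Opens E3)

/-! ### Differential operators for functions on an open set `D` -/

/-- The partial derivative `∂ᵢ f` of a function on the open set `D`. The function is extended by zero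
to the whole space; as `D` is open, the value at a point of `D` does not depend on the extension. -/
def partialD (i : Fin 3) (f : D → ℝ) : D → ℝ :=
  fun x => lineDeriv ℝ (Function.extend Subtype.val f 0) (x : E3) (dir i)

/-- The gradient of a vector field, `(∇ v)ᵢⱼ = ∂ⱼ vᵢ`. -/
def grad (v : D → Fin 3 → ℝ) : D → Mat3 :=
  fun x => Matrix.of fun i j => partialD D j (fun y => v y i) x

/-- The curl of a vector field. -/
def curlVec (v : D → Fin 3 → ℝ) : D → Fin 3 → ℝ :=
  fun x =>
    ![partialD D 1 (fun y => v y 2) x - partialD D 2 (fun y => v y 1) x,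
      partialD D 2 (fun y => v y 0) x - partialD D 0 (fun y => v y 2) x,
      partialD D 0 (fun y => v y 1) x - partialD D 1 (fun y => v y 0) x]

/-- The divergence of a vector field. -/
def divVec (v : D → Fin 3 → ℝ) : D → ℝ :=
  fun x => ∑ i, partialD D i (fun y => v y i) x

/-- The curl of a matrix field, applied by row. -/
def curl (u : D → Mat3) : D → Mat3 :=
  fun x => Matrix.of fun i => curlVec D (fun y => u y i) x

/-- The divergence of a matrix field, applied by row. -/
def div (σ : D → Mat3) : D → Fin 3 → ℝ :=
  fun x i => divVec D (fun y => σ y i) x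

/-- The symmetric part of a matrix. -/
def symPart (A : Mat3) : Mat3 := (1 / 2 : ℝ) • (A + A.transpose)

/-- The traceless part of a matrix. -/
def devPart (A : Mat3) : Mat3 := A - ((1 / 3 : ℝ) * A.trace) • (1 : Mat3)

/-- The operator `dev grad`. -/
def devGrad (v : D → Fin 3 → ℝ) : D → Mat3 := fun x => devPart (grad D v x)

/-- The operator `sym curl`. -/
def symCurl (u : D → Mat3) : D → Mat3 := fun x => symPart (curl D u x)

/-- The operator `div div`. -/
def divDiv (σ : D → Mat3) : D → ℝ := divVec D (div D σ)

/-! ### The Sobolev space `H¹(D)` -/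

/-- Lebesgue measure on `D`. -/
def volD : Measure D := Measure.comap Subtype.val (volume : Measure E3)

/-- `g` is a weak `i`-th partial derivative of `f` on `D`. -/
def IsWeakPartial (i : Fin 3) (f g : D → ℝ) : Prop :=
  ∀ φ : E3 → ℝ, ContDiff ℝ ∞ φ → HasCompactSupport φ → tsupport φ ⊆ (D : Set E3) →
    ∫ x : D, f x * lineDeriv ℝ φ (x : E3) (dir i) ∂(volD D) = -∫ x : D, g x * φ (x : E3) ∂(volD D)

/-- Membership in `H¹(D; ℝ)`: square integrable, with square integrable weak first derivatives. -/
def MemH1 (f : D → ℝ) : Prop :=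
  MemLp f 2 (volD D) ∧ ∀ i, ∃ g : D → ℝ, MemLp g 2 (volD D) ∧ IsWeakPartial D i f g

variable {D}

lemma integrable_mul_of_compact {f : D → ℝ} (hf : MemLp f 2 (volD D)) {ψ : E3 → ℝ}
    (hc : Continuous ψ) (hs : HasCompactSupport ψ) :
    Integrable (fun x : D => f x * ψ (x : E3)) (volD D) := by
  have h1 : MemLp ψ 2 (volume.restrict (D : Set E3)) := (hc.memLp_of_hasCompactSupport hs).restrict _
  have h2 : MemLp (fun x : D => ψ (x : E3)) 2 (volD D) :=
    h1.comp_measurePreserving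
      (measurePreserving_subtype_coe D.isOpen.measurableSet)
  exact hf.integrable_mul h2

lemma continuous_lineDeriv {φ : E3 → ℝ} (h : ContDiff ℝ ∞ φ) (i : Fin 3) :
    Continuous fun x => lineDeriv ℝ φ x (dir i) := by
  have h1 : Differentiable ℝ φ := h.differentiable (by simp)
  have h2 : (fun x => lineDeriv ℝ φ x (dir i)) = fun x => fderiv ℝ φ x (dir i) := by
    ext x
    exact (h1 x).lineDeriv_eq_fderiv
  rw [h2]
  exact (h.continuous_fderiv (by simp)).clm_apply continuous_const

lemma hasCompactSupport_lineDeriv {φ : E3 → ℝ} (h : ContDiff ℝ ∞ φ) (hs : HasCompactSupport φ)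
    (i : Fin 3) : HasCompactSupport fun x => lineDeriv ℝ φ x (dir i) := by
  have h1 : Differentiable ℝ φ := h.differentiable (by simp)
  have h2 : (fun x => lineDeriv ℝ φ x (dir i)) = fun x => fderiv ℝ φ x (dir i) := by
    ext x
    exact (h1 x).lineDeriv_eq_fderiv
  rw [h2]
  exact hs.fderiv_apply ℝ (dir i)

lemma MemH1.zero : MemH1 D (0 : D → ℝ) := by
  refine ⟨MemLp.zero, fun i => ⟨0, MemLp.zero, ?_⟩⟩
  intro φ _ _ _
  simp

lemma MemH1.add {f f' : D → ℝ} (hf : MemH1 D f) (hf' : MemH1 D f') : MemH1 D (f + f') := by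
  refine ⟨hf.1.add hf'.1, fun i => ?_⟩
  obtain ⟨g, hg, hw⟩ := hf.2 i
  obtain ⟨g', hg', hw'⟩ := hf'.2 i
  refine ⟨g + g', hg.add hg', ?_⟩
  intro φ h1 h2 h3
  have c := continuous_lineDeriv h1 i
  have s := hasCompactSupport_lineDeriv h1 h2 i
  simp only [Pi.add_apply, add_mul]
  rw [integral_add (integrable_mul_of_compact hf.1 c s) (integrable_mul_of_compact hf'.1 c s),
    integral_add (integrable_mul_of_compact hg h1.continuous h2)
      (integrable_mul_of_compact hg' h1.continuous h2), hw φ h1 h2 h3, hw' φ h1 h2 h3]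
  ring

lemma MemH1.smul {f : D → ℝ} (c : ℝ) (hf : MemH1 D f) : MemH1 D (c • f) := by
  refine ⟨hf.1.const_smul c, fun i => ?_⟩
  obtain ⟨g, hg, hw⟩ := hf.2 i
  refine ⟨c • g, hg.const_smul c, ?_⟩
  intro φ h1 h2 h3
  simp only [Pi.smul_apply, smul_eq_mul, mul_assoc]
  rw [integral_const_mul, integral_const_mul, hw φ h1 h2 h3]
  ring

variable (D)

/-- `H¹(D; 𝕄)`, componentwise. -/
def H1Mat : Submodule ℝ (D → Mat3) where
  carrier := {σ | ∀ i j, MemH1 D fun x => σ x i j}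
  zero_mem' := fun _ _ => MemH1.zero
  add_mem' := fun h h' i j => (h i j).add (h' i j)
  smul_mem' := fun c _ h i j => (h i j).smul c

/-- `H¹(D; 𝕊)`: fields of symmetric matrices. -/
def H1Sym : Submodule ℝ (D → Mat3) where
  carrier := {σ | σ ∈ H1Mat D ∧ ∀ x, (σ x).IsSymm}
  zero_mem' := ⟨zero_mem _, fun _ => Matrix.isSymm_zero⟩
  add_mem' := fun h h' => ⟨add_mem h.1 h'.1, fun x => (h.2 x).add (h'.2 x)⟩
  smul_mem' := fun c _ h => ⟨Submodule.smul_mem _ c h.1, fun x => (h.2 x).smul c⟩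

/-- `H¹(D; 𝕋)`: fields of traceless matrices. -/
def H1Traceless : Submodule ℝ (D → Mat3) where
  carrier := {u | u ∈ H1Mat D ∧ ∀ x, (u x).trace = 0}
  zero_mem' := ⟨zero_mem _, fun _ => Matrix.trace_zero _ _⟩
  add_mem' := fun h h' => ⟨add_mem h.1 h'.1, fun x => by
    rw [Pi.add_apply, Matrix.trace_add, h.2 x, h'.2 x, add_zero]⟩
  smul_mem' := fun c _ h => ⟨Submodule.smul_mem _ c h.1, fun x => by
    rw [Pi.smul_apply, Matrix.trace_smul, h.2 x, smul_zero]⟩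

/-! ### Polynomial spaces -/

/-- `P_{k₁ k₂ k₃}(D)`: the functions on `D` that are linear combinations of the monomials
`x₁ ^ s₁ * x₂ ^ s₂ * x₃ ^ s₃` with `sᵢ ≤ kᵢ`. -/
def polyP (k₁ k₂ k₃ : ℕ) : Submodule ℝ (D → ℝ) :=
  Submodule.span ℝ {f | ∃ s₁ s₂ s₃ : ℕ, s₁ ≤ k₁ ∧ s₂ ≤ k₂ ∧ s₃ ≤ k₃ ∧
    f = fun x : D => (x : E3) 0 ^ s₁ * (x : E3) 1 ^ s₂ * (x : E3) 2 ^ s₃}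

/-- `Q_k(D; ℝ)`: polynomials of degree at most `k` in each variable. -/
def polyQ (k : ℕ) : Submodule ℝ (D → ℝ) := polyP D k k k

variable {D}

/-- The product `A × B × C` of spaces of scalar functions, as a space of vector fields. -/
def prodSpace (A B C : Submodule ℝ (D → ℝ)) : Submodule ℝ (D → Fin 3 → ℝ) where
  carrier := {v | (fun x => v x 0) ∈ A ∧ (fun x => v x 1) ∈ B ∧ (fun x => v x 2) ∈ C}
  zero_mem' := ⟨zero_mem A, zero_mem B, zero_mem C⟩
  add_mem' := fun h h' => ⟨add_mem h.1 h'.1, add_mem h.2.1 h'.2.1, add_mem h.2.2 h'.2.2⟩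
  smul_mem' := fun c _ h =>
    ⟨A.smul_mem c h.1, B.smul_mem c h.2.1, C.smul_mem c h.2.2⟩

/-- `𝒫ₙ u = (u₁₁, u₂₂, u₃₃)`. -/
def normalPart : (D → Mat3) →ₗ[ℝ] (D → Fin 3 → ℝ) where
  toFun u := fun x => ![u x 0 0, u x 1 1, u x 2 2]
  map_add' u v := by ext x i; fin_cases i <;> rfl
  map_smul' c u := by ext x i; fin_cases i <;> rfl

/-- `𝒫ₜ u = (u₁₂, u₁₃, u₂₃)`. -/
def shearPart : (D → Mat3) →ₗ[ℝ] (D → Fin 3 → ℝ) where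
  toFun u := fun x => ![u x 0 1, u x 0 2, u x 1 2]
  map_add' u v := by ext x i; fin_cases i <;> rfl
  map_smul' c u := by ext x i; fin_cases i <;> rfl

/-- The pointwise transpose of a matrix field. -/
def transposeField : (D → Mat3) →ₗ[ℝ] (D → Mat3) where
  toFun u := fun x => (u x).transpose
  map_add' _ _ := rfl
  map_smul' _ _ := rfl

variable (D)

/-- `RT(D) = {a x + b : a ∈ ℝ, b ∈ ℝ³}`. -/
def RT : Submodule ℝ (D → Fin 3 → ℝ) where
  carrier := {v | ∃ (a : ℝ) (b : Fin 3 → ℝ), v = fun (x : D) i => a * (x : E3) i + b i}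
  zero_mem' := ⟨0, 0, by ext x i; simp⟩
  add_mem' := by
    rintro _ _ ⟨a, b, rfl⟩ ⟨a', b', rfl⟩
    exact ⟨a + a', b + b', by ext x i; simp only [Pi.add_apply]; ring⟩
  smul_mem' := by
    rintro c _ ⟨a, b, rfl⟩
    exact ⟨c * a, c • b, by ext x i; simp only [Pi.smul_apply, smul_eq_mul]; ring⟩

/-- `V_{[k]}(D; ℝ³)`, meant for `k ≥ 1`. -/
def VSpace (k : ℕ) : Submodule ℝ (D → Fin 3 → ℝ) :=
  prodSpace (polyP D k (k - 1) (k - 1)) (polyP D (k - 1) k (k - 1)) (polyP D (k - 1) (k - 1) k)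

/-- `𝒰_{[k]}(D; 𝕋)`, meant for `k ≥ 2`. -/
def USpace (k : ℕ) : Submodule ℝ (D → Mat3) :=
  H1Traceless D ⊓
  (prodSpace (polyQ D (k - 1)) (polyQ D (k - 1)) (polyQ D (k - 1))).comap normalPart ⊓
  (prodSpace (polyP D k (k - 2) (k - 1)) (polyP D k (k - 1) (k - 2))
    (polyP D (k - 1) k (k - 2))).comap shearPart ⊓
  (prodSpace (polyP D (k - 2) k (k - 1)) (polyP D (k - 2) (k - 1) k)
    (polyP D (k - 1) (k - 2) k)).comap (shearPart ∘ₗ transposeField)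

/-- `Σ_{[k]}(D; 𝕊)`, meant for `k ≥ 2`. -/
def SigmaSpace (k : ℕ) : Submodule ℝ (D → Mat3) :=
  H1Sym D ⊓
  (prodSpace (polyP D k (k - 2) (k - 2)) (polyP D (k - 2) k (k - 2))
    (polyP D (k - 2) (k - 2) k)).comap normalPart ⊓
  (prodSpace (polyP D (k - 1) (k - 1) (k - 2)) (polyP D (k - 1) (k - 2) (k - 1))
    (polyP D (k - 2) (k - 1) (k - 1))).comap shearPart

end DivDiv

end

/-!
On a bounded domain every function occurring in the sequence is a polynomial, and polynomials
restrict injectively to a nonempty open set (`ev_injective`), have their formal derivatives as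
analytic ones (`partialD_ev`) and lie in `H¹` (`memH1_ev`). So the spaces are images of spaces of
polynomial fields, each entry having a bounded degree in each variable, and exactness is a
statement about polynomials.

It is proved there by writing down potentials with the antiderivative `∫ᵢ` that vanishes on `xᵢ =
0`; `∫ᵢ` commutes with the other partial derivatives and raises only the degree in `xᵢ`, by one.

* `dev grad v = 0` says that `vᵢ` depends on `xᵢ` only and that all `∂ᵢ vᵢ` agree; then they are
  constant (`exists_of_pDevGrad_eq_zero`).
* If `sym curl u = 0`, its diagonal entries say that the off-diagonal entries of the `i`-th row of
  `u` form a gradient in the two variables other than `xᵢ`. Integrating them and subtracting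
  leaves a diagonal field, whose differences of entries depend on two variables each and sum to
  zero; they are differences of functions of one variable (`exists_separated`), which are
  integrated once more (`exists_pDevGrad_eq`).
* If `div div σ = 0`, the entries `u₁₃`, `u₂₁`, `u₃₂` of a potential can be chosen as
  antiderivatives of `σ₁₁`, `σ₂₂`, `σ₃₃`. A diagonal potential is to produce the rest, so its
  differences of entries have prescribed derivatives `∂₃`, `∂₂`, `∂₁`. Antiderivatives `a`, `b`,
  `c` of these satisfy `∂₁ ∂₂ ∂₃ (a + b + c) = 0` because of `div div σ = 0`, so the constants of
  integration can be chosen to make the sum vanish (`exists_sum_eq_zero`, `exists_pSymCurl_eq`).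
* Integrating twice in `x₁` shows that `div div` is onto (`exists_pDivDiv_eq`).

In the Lean text the variables are numbered from `0`.
-/

noncomputable section

namespace DivDiv

open MvPolynomial

/-! ### Polynomials with bounded partial degrees -/

/-- Real polynomials in three variables. -/
abbrev Poly : Type := MvPolynomial (Fin 3) ℝ

/-- The polynomials of degree at most `d i` in the variable `X i`, for each `i`. -/
def box (d : Fin 3 → ℕ) : Submodule ℝ Poly := restrictSupport ℝ {s | ∀ i, s i ≤ d i}

lemma box_eq_span (d : Fin 3 → ℕ) :
    box d = Submodule.span ℝ ((monomial · 1) '' {s : Fin 3 →₀ ℕ | ∀ i, s i ≤ d i}) :=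
  restrictSupport_eq_span _ _

lemma box_mono {d e : Fin 3 → ℕ} (h : ∀ i, d i ≤ e i) : box d ≤ box e :=
  restrictSupport_mono _ fun _ hs i => (hs i).trans (h i)

lemma monomial_mem_box {d : Fin 3 → ℕ} {s : Fin 3 →₀ ℕ} (h : ∀ i, s i ≤ d i) (c : ℝ) :
    monomial s c ∈ box d :=
  (monomial_mem_restrictSupport ℝ).2 (Or.inl h)

/-- A linear map carries `box d` into a submodule as soon as it does so for monomials. -/
lemma map_mem_of_monomial {M : Type*} [AddCommGroup M] [Module ℝ M] {d : Fin 3 → ℕ}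
    {S : Submodule ℝ M} (f : Poly →ₗ[ℝ] M)
    (h : ∀ s : Fin 3 →₀ ℕ, (∀ i, s i ≤ d i) → f (monomial s 1) ∈ S) {p : Poly} (hp : p ∈ box d) :
    f p ∈ S := by
  have : box d ≤ S.comap f := by
    rw [box_eq_span, Submodule.span_le]
    rintro _ ⟨s, hs, rfl⟩
    exact h s hs
  exact this hp

/-- The partial derivative `∂ᵢ` as an `ℝ`-linear map on polynomials. -/
def pd (i : Fin 3) : Poly →ₗ[ℝ] Poly := (pderiv i : Derivation ℝ Poly Poly).toLinearMap

lemma pd_apply (i : Fin 3) (p : Poly) : pd i p = pderiv i p := rfl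

lemma pd_monomial (i : Fin 3) (s : Fin 3 →₀ ℕ) (c : ℝ) :
    pd i (monomial s c) = monomial (s - Finsupp.single i 1) (c * s i) := pderiv_monomial

/-- The antiderivative in the variable `X i` that vanishes where `X i = 0`. -/
def antideriv (i : Fin 3) : Poly →ₗ[ℝ] Poly :=
  (basisMonomials (Fin 3) ℝ).constr ℝ fun s => monomial (s + Finsupp.single i 1) ((s i + 1 : ℝ)⁻¹)

lemma antideriv_monomial (i : Fin 3) (s : Fin 3 →₀ ℕ) (c : ℝ) :
    antideriv i (monomial s c) = monomial (s + Finsupp.single i 1) (c * (s i + 1 : ℝ)⁻¹) := by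
  have h1 : antideriv i (monomial s 1) = monomial (s + Finsupp.single i 1) ((s i + 1 : ℝ)⁻¹) := by
    have := (basisMonomials (Fin 3) ℝ).constr_basis ℝ
      (fun s => (monomial (s + Finsupp.single i 1) ((s i + 1 : ℝ)⁻¹) : Poly)) s
    simpa [antideriv] using this
  have h2 : (monomial s c : Poly) = c • monomial s 1 := by simp [smul_monomial]
  rw [h2, map_smul, h1, smul_monomial, smul_eq_mul]

lemma linearMap_ext {f g : Poly →ₗ[ℝ] Poly} (h : ∀ s, f (monomial s 1) = g (monomial s 1))
    (p : Poly) : f p = g p := by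
  have : f = g := (basisMonomials (Fin 3) ℝ).ext fun s => by simpa using h s
  rw [this]

lemma pd_comm (i j : Fin 3) (p : Poly) : pd i (pd j p) = pd j (pd i p) := by
  refine linearMap_ext (f := pd i ∘ₗ pd j) (g := pd j ∘ₗ pd i) (fun s => ?_) p
  by_cases h : i = j
  · rw [h]
  have h' : j ≠ i := fun e => h e.symm
  simp only [LinearMap.comp_apply, pd_monomial, Finsupp.tsub_apply, Finsupp.single_apply, h, h',
    if_false, tsub_zero, one_mul]
  rw [tsub_right_comm, mul_comm]

@[simp]
lemma pd_antideriv_self (i : Fin 3) (p : Poly) : pd i (antideriv i p) = p := by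
  refine linearMap_ext (f := pd i ∘ₗ antideriv i) (g := LinearMap.id) (fun s => ?_) p
  have : (s i + 1 : ℝ) ≠ 0 := by positivity
  simp [pd_monomial, antideriv_monomial, this]

lemma pd_antideriv_of_ne {i j : Fin 3} (h : i ≠ j) (p : Poly) :
    pd i (antideriv j p) = antideriv j (pd i p) := by
  refine linearMap_ext (f := pd i ∘ₗ antideriv j) (g := antideriv j ∘ₗ pd i) (fun s => ?_) p
  have h' : j ≠ i := fun e => h e.symm
  simp only [LinearMap.comp_apply, pd_monomial, antideriv_monomial]
  by_cases hs : s i = 0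
  · simp [hs, h']
  · have e : s + Finsupp.single j 1 - Finsupp.single i 1
        = s - Finsupp.single i 1 + Finsupp.single j 1 := by
      ext l
      simp only [Finsupp.tsub_apply, Finsupp.add_apply, Finsupp.single_apply]
      split_ifs <;> simp_all
    rw [e]
    simp [h, h', mul_comm]

/-- Restriction to the plane `X i = 0`. It is encoded through the fundamental theorem of calculus
as `p ↦ p - ∫ᵢ ∂ᵢ p`. -/
def restr (i : Fin 3) : Poly →ₗ[ℝ] Poly := LinearMap.id - antideriv i ∘ₗ pd i

lemma restr_apply (i : Fin 3) (p : Poly) : restr i p = p - antideriv i (pd i p) := rfl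

lemma pd_restr_self (i : Fin 3) (p : Poly) : pd i (restr i p) = 0 := by
  simp [restr_apply]

lemma pd_restr_of_ne {i j : Fin 3} (h : i ≠ j) (p : Poly) :
    pd i (restr j p) = restr j (pd i p) := by
  simp [restr_apply, pd_antideriv_of_ne h, pd_comm i j]

lemma restr_eq_self {i : Fin 3} {p : Poly} (h : pd i p = 0) : restr i p = p := by
  simp [restr_apply, h]

lemma pd_mem_box {d e : Fin 3 → ℕ} (i : Fin 3) (h : ∀ l, d l - (if l = i then 1 else 0) ≤ e l)
    {p : Poly} (hp : p ∈ box d) : pd i p ∈ box e := by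
  refine map_mem_of_monomial (pd i) (fun s hs => ?_) hp
  rw [pd_monomial]
  refine monomial_mem_box (fun l => ?_) _
  have h1 := h l
  have h2 := hs l
  simp only [Finsupp.tsub_apply, Finsupp.single_apply, eq_comm (a := i)]
  omega

lemma antideriv_mem_box {d e : Fin 3 → ℕ} (i : Fin 3)
    (h : ∀ l, d l + (if l = i then 1 else 0) ≤ e l)
    {p : Poly} (hp : p ∈ box d) : antideriv i p ∈ box e := by
  refine map_mem_of_monomial (antideriv i) (fun s hs => ?_) hp
  rw [antideriv_monomial]
  refine monomial_mem_box (fun l => ?_) _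
  have h1 := h l
  have h2 := hs l
  simp only [Finsupp.add_apply, Finsupp.single_apply, eq_comm (a := i)]
  omega

lemma restr_mem_box {d : Fin 3 → ℕ} (i : Fin 3) {p : Poly} (hp : p ∈ box d) :
    restr i p ∈ box d := by
  refine map_mem_of_monomial (restr i) (fun s hs => ?_) hp
  rw [restr_apply, pd_monomial, antideriv_monomial]
  refine sub_mem (monomial_mem_box hs _) ?_
  by_cases h : s i = 0
  · simp [h]
  · refine monomial_mem_box (fun l => ?_) _
    have h2 := hs l
    simp only [Finsupp.add_apply, Finsupp.tsub_apply, Finsupp.single_apply]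
    split_ifs with hl
    · subst hl
      omega
    · omega

/-- A polynomial all of whose partial derivatives vanish is constant. -/
lemma eq_C_of_pd_eq_zero {p : Poly} (h : ∀ i, pd i p = 0) : ∃ c : ℝ, p = C c := by
  refine ⟨coeff 0 p, ?_⟩
  ext s
  rw [coeff_C]
  split_ifs with hs
  · rw [hs]
  · obtain ⟨i, hi⟩ : ∃ i, s i ≠ 0 := by
      by_contra! hc
      exact hs (Finsupp.ext fun i => (hc i).symm)
    have h1 := congrArg (coeff (s - Finsupp.single i 1)) (h i)
    rw [pd_apply, coeff_pderiv] at h1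
    have e : s - Finsupp.single i 1 + Finsupp.single i 1 = s :=
      tsub_add_cancel_of_le (by simpa [Finsupp.single_le_iff] using Nat.one_le_iff_ne_zero.2 hi)
    rw [e, coeff_zero] at h1
    have h2 : (((s - Finsupp.single i 1 : Fin 3 →₀ ℕ) i : ℝ) + 1) ≠ 0 := by positivity
    exact (mul_eq_zero.1 h1).resolve_right h2

/-- The Poincaré lemma in two of the variables, with an explicit potential. -/
lemma pd_potential {i j : Fin 3} (hij : i ≠ j) {p q : Poly} (h : pd j p = pd i q) :
    pd i (antideriv i p + restr i (antideriv j q)) = p ∧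
      pd j (antideriv i p + restr i (antideriv j q)) = q := by
  constructor
  · rw [map_add, pd_antideriv_self, pd_restr_self, add_zero]
  · rw [map_add, pd_antideriv_of_ne hij.symm, h, pd_restr_of_ne hij.symm, pd_antideriv_self,
      restr_apply, add_sub_cancel]

/-! ### Polynomials as functions on `D` -/

variable (D : TopologicalSpace.Opens E3)

/-- A polynomial as a function on `D`. -/
def ev : Poly →ₗ[ℝ] (D → ℝ) where
  toFun p := fun x => eval (fun i => (x : E3) i) p
  map_add' p q := by ext x; simp
  map_smul' c p := by ext x; simp [smul_eval]

lemma ev_apply (p : Poly) (x : D) : ev D p x = eval (fun i => (x : E3) i) p := rfl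

lemma hasLineDerivAt_eval (i : Fin 3) (p : Poly) (x : E3) :
    HasLineDerivAt ℝ (fun y : E3 => eval (fun l => y l) p) (eval (fun l => x l) (pd i p)) x
      (dir i) := by
  unfold HasLineDerivAt
  induction p using MvPolynomial.induction_on with
  | C a => simpa [pd_apply] using hasDerivAt_const (0 : ℝ) a
  | add p q hp hq => simpa using hp.fun_add hq
  | mul_X p j hp =>
    have hX : HasDerivAt (fun t : ℝ => (x + t • dir i) j) (if i = j then 1 else 0) 0 := by
      have : HasDerivAt (fun t : ℝ => x j + t * dir i j) (dir i j) 0 := by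
        simpa using ((hasDerivAt_id (0 : ℝ)).mul_const (dir i j)).const_add (x j)
      simpa [dir, eq_comm] using this
    simp only [eval_mul, eval_X]
    refine (hp.fun_mul hX).congr_deriv ?_
    simp only [zero_smul, add_zero, pd_apply, pderiv_mul, pderiv_X, Pi.single_apply,
      eq_comm (a := j)]
    split_ifs <;> simp

lemma contDiff_eval (p : Poly) : ContDiff ℝ ∞ (fun y : E3 => eval (fun l => y l) p) := by
  induction p using MvPolynomial.induction_on with
  | C a => simpa using contDiff_const
  | add p q hp hq => simpa using hp.add hq
  | mul_X p j hp =>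
    have : ContDiff ℝ ∞ fun y : E3 => y j := by fun_prop
    simpa using hp.mul this

variable {D}

/-- On polynomial functions the analytic partial derivative is the formal one. -/
lemma partialD_ev (i : Fin 3) (p : Poly) : partialD D i (ev D p) = ev D (pd i p) := by
  ext x
  have h : Function.extend Subtype.val (ev D p) 0 =ᶠ[nhds (x : E3)]
      fun y : E3 => eval (fun l => y l) p := by
    filter_upwards [D.isOpen.mem_nhds x.2] with y hy
    exact Subtype.val_injective.extend_apply (ev D p) 0 (⟨y, hy⟩ : D)
  rw [partialD, h.lineDeriv_eq]
  exact (hasLineDerivAt_eval i p x).lineDeriv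

/-- A nonempty open set contains a product of three infinite sets, so a polynomial is determined by
its values there. -/
lemma ev_injective (hD : (D : Set E3).Nonempty) : Function.Injective (ev D) := by
  obtain ⟨x, hx⟩ := hD
  intro p q hpq
  have hopen : IsOpen ((EuclideanSpace.equiv (Fin 3) ℝ).symm ⁻¹' (D : Set E3)) :=
    D.isOpen.preimage (EuclideanSpace.equiv (Fin 3) ℝ).symm.continuous
  obtain ⟨ε, hε, hball⟩ := Metric.isOpen_iff.1 hopen (EuclideanSpace.equiv (Fin 3) ℝ x)
    (by simpa using hx)
  rw [ball_pi _ hε] at hball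
  refine funext_set (fun i => Metric.ball (EuclideanSpace.equiv (Fin 3) ℝ x i) ε)
    (fun i => ?_) fun y hy => ?_
  · rw [Real.ball_eq_Ioo]
    exact Set.Ioo_infinite (by linarith)
  · exact congrFun hpq ⟨(EuclideanSpace.equiv (Fin 3) ℝ).symm y, hball hy⟩

lemma memLp_ev (hbdd : Bornology.IsBounded (D : Set E3)) (p : Poly) :
    MemLp (ev D p) 2 (volD D) := by
  have hcont := (contDiff_eval p).continuous
  obtain ⟨K, hK⟩ := hbdd.isCompact_closure.exists_bound_of_continuousOn hcont.continuousOn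
  have : IsFiniteMeasure (volume.restrict (D : Set E3)) :=
    ⟨by simpa using hbdd.measure_lt_top⟩
  have h : MemLp (fun y : E3 => eval (fun l => y l) p) 2 (volume.restrict (D : Set E3)) := by
    refine MemLp.of_bound hcont.aestronglyMeasurable K ?_
    exact (ae_restrict_mem D.isOpen.measurableSet).mono fun y hy => hK y (subset_closure hy)
  exact h.comp_measurePreserving (measurePreserving_subtype_coe D.isOpen.measurableSet)

lemma isWeakPartial_ev (i : Fin 3) (p : Poly) :
    IsWeakPartial D i (ev D p) (ev D (pd i p)) := by
  intro φ hφ hc hs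
  have hzero : ∀ y ∉ (D : Set E3), φ y = 0 := fun y hy =>
    image_eq_zero_of_notMem_tsupport fun h => hy (hs h)
  have hdiff : Differentiable ℝ φ := hφ.differentiable (by simp)
  have hzero' : ∀ y ∉ (D : Set E3), lineDeriv ℝ φ y (dir i) = 0 := by
    intro y hy
    rw [(hdiff y).lineDeriv_eq_fderiv, fderiv_of_notMem_tsupport ℝ fun h => hy (hs h)]
    rfl
  have h1 : ∫ x : D, ev D p x * lineDeriv ℝ φ (x : E3) (dir i) ∂(volD D)
      = ∫ y : E3, eval (fun l => y l) p * lineDeriv ℝ φ y (dir i) := by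
    rw [← setIntegral_eq_integral_of_forall_compl_eq_zero (s := (D : Set E3))
      fun y hy => by rw [hzero' y hy, mul_zero]]
    exact integral_subtype_comap D.isOpen.measurableSet
      fun y : E3 => eval (fun l => y l) p * lineDeriv ℝ φ y (dir i)
  have h2 : ∫ x : D, ev D (pd i p) x * φ (x : E3) ∂(volD D)
      = ∫ y : E3, eval (fun l => y l) (pd i p) * φ y := by
    rw [← setIntegral_eq_integral_of_forall_compl_eq_zero (s := (D : Set E3))
      fun y hy => by rw [hzero y hy, mul_zero]]
    exact integral_subtype_comap D.isOpen.measurableSet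
      fun y : E3 => eval (fun l => y l) (pd i p) * φ y
  have hint : ∀ (q : Poly) {ψ : E3 → ℝ}, Continuous ψ → HasCompactSupport ψ →
      Integrable fun y : E3 => eval (fun l => y l) q * ψ y := fun q ψ hψ hψc =>
    ((contDiff_eval q).continuous.mul hψ).integrable_of_hasCompactSupport hψc.mul_left
  rw [h1, h2]
  exact integral_bilinear_hasLineDerivAt_right_eq_neg_left_of_integrable (μ := volume)
    (B := ContinuousLinearMap.mul ℝ ℝ) (hint _ hφ.continuous hc)
    (hint _ (continuous_lineDeriv hφ i) (hasCompactSupport_lineDeriv hφ hc i))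
    (hint _ hφ.continuous hc) (fun y _ => hasLineDerivAt_eval i p y)
    (fun y _ => (hdiff y).lineDifferentiableAt.hasLineDerivAt)

lemma memH1_ev (hbdd : Bornology.IsBounded (D : Set E3)) (p : Poly) : MemH1 D (ev D p) :=
  ⟨memLp_ev hbdd p, fun i => ⟨ev D (pd i p), memLp_ev hbdd _, isWeakPartial_ev i p⟩⟩

variable (D) in
/-- The function space `P_{k₁ k₂ k₃}(D)` is the image of the polynomials with these degrees. -/
lemma polyP_eq_map (d : Fin 3 → ℕ) : polyP D (d 0) (d 1) (d 2) = (box d).map (ev D) := by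
  rw [box_eq_span, Submodule.map_span, polyP]
  congr 1
  ext f
  simp only [Set.mem_ofPred_eq, Set.mem_image, exists_exists_and_eq_and]
  have hev : ∀ s : Fin 3 →₀ ℕ, ev D (monomial s 1) =
      fun x : D => (x : E3) 0 ^ s 0 * (x : E3) 1 ^ s 1 * (x : E3) 2 ^ s 2 := by
    intro s
    ext x
    rw [ev_apply, eval_monomial, Finsupp.prod_fintype _ _ (by simp), Fin.prod_univ_three, one_mul]
  constructor
  · rintro ⟨a, b, c, ha, hb, hc, rfl⟩
    refine ⟨Finsupp.equivFunOnFinite.symm ![a, b, c], ?_, by simp [hev]⟩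
    intro i
    fin_cases i <;> simpa
  · rintro ⟨s, hs, rfl⟩
    exact ⟨s 0, s 1, s 2, hs 0, hs 1, hs 2, hev s⟩

lemma mem_polyP_iff {d : Fin 3 → ℕ} {f : D → ℝ} :
    f ∈ polyP D (d 0) (d 1) (d 2) ↔ ∃ p ∈ box d, ev D p = f := by
  rw [polyP_eq_map, Submodule.mem_map]

/-! ### The complex of polynomial fields -/

/-- Vector fields with polynomial coefficients. -/
abbrev PVec : Type := Fin 3 → Poly

/-- Matrix fields with polynomial coefficients. -/
abbrev PMat : Type := Matrix (Fin 3) (Fin 3) Poly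

/-- The operator `dev grad` on polynomial fields. -/
def pDevGrad : PVec →ₗ[ℝ] PMat where
  toFun v := Matrix.of fun i j =>
    pd j (v i) - if i = j then (1 / 3 : ℝ) • ∑ l, pd l (v l) else 0
  map_add' v w := by
    ext1 i j
    simp only [Pi.add_apply, map_add, Finset.sum_add_distrib, Matrix.of_apply, Matrix.add_apply]
    split_ifs <;> module
  map_smul' c v := by
    ext1 i j
    simp only [Pi.smul_apply, map_smul, ← Finset.smul_sum, Matrix.of_apply, Matrix.smul_apply,
      RingHom.id_apply]
    split_ifs <;> module

/-- The curl of a polynomial vector field. -/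
def pCurlVec : PVec →ₗ[ℝ] PVec where
  toFun v := ![pd 1 (v 2) - pd 2 (v 1), pd 2 (v 0) - pd 0 (v 2), pd 0 (v 1) - pd 1 (v 0)]
  map_add' v w := by
    ext1 i
    fin_cases i <;> simp <;> abel
  map_smul' c v := by
    ext1 i
    fin_cases i <;> simp [smul_sub]

/-- The operator `sym curl` on polynomial fields. -/
def pSymCurl : PMat →ₗ[ℝ] PMat where
  toFun u := Matrix.of fun i j => (1 / 2 : ℝ) • (pCurlVec (u i) j + pCurlVec (u j) i)
  map_add' u w := by
    ext1 i j
    have h : ∀ l, (u + w) l = u l + w l := fun _ => rfl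
    simp only [Matrix.of_apply, h, map_add, Pi.add_apply, Matrix.add_apply]
    module
  map_smul' c u := by
    ext1 i j
    have h : ∀ l, (c • u) l = c • u l := fun _ => rfl
    simp only [Matrix.of_apply, h, map_smul, Pi.smul_apply, Matrix.smul_apply, RingHom.id_apply]
    module

/-- The operator `div div` on polynomial fields. -/
def pDivDiv : PMat →ₗ[ℝ] Poly where
  toFun σ := ∑ i, pd i (∑ j, pd j (σ i j))
  map_add' σ τ := by simp [Finset.sum_add_distrib]
  map_smul' c σ := by simp [Finset.smul_sum]

lemma pDevGrad_apply (v : PVec) (i j : Fin 3) :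
    pDevGrad v i j = pd j (v i) - if i = j then (1 / 3 : ℝ) • ∑ l, pd l (v l) else 0 := rfl

lemma pSymCurl_apply (u : PMat) (i j : Fin 3) :
    pSymCurl u i j = (1 / 2 : ℝ) • (pCurlVec (u i) j + pCurlVec (u j) i) := rfl

lemma pDivDiv_apply (σ : PMat) : pDivDiv σ = ∑ i, pd i (∑ j, pd j (σ i j)) := rfl

lemma pCurlVec_zero (v : PVec) : pCurlVec v 0 = pd 1 (v 2) - pd 2 (v 1) := rfl

lemma pCurlVec_one (v : PVec) : pCurlVec v 1 = pd 2 (v 0) - pd 0 (v 2) := rfl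

lemma pCurlVec_two (v : PVec) : pCurlVec v 2 = pd 0 (v 1) - pd 1 (v 0) := rfl

lemma trace_pDevGrad (v : PVec) : (pDevGrad v).trace = 0 := by
  simp only [Matrix.trace, Matrix.diag_apply, Fin.sum_univ_three, pDevGrad_apply, if_true]
  module

lemma isSymm_pSymCurl (u : PMat) : (pSymCurl u).IsSymm := by
  ext1 i j
  rw [Matrix.transpose_apply, pSymCurl_apply, pSymCurl_apply, add_comm]

lemma pSymCurl_pDevGrad (v : PVec) : pSymCurl (pDevGrad v) = 0 := by
  ext1 i j
  fin_cases i <;> fin_cases j <;>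
    simp [pSymCurl_apply, pCurlVec_zero, pCurlVec_one, pCurlVec_two, pDevGrad_apply,
      Fin.sum_univ_three, pd_comm 1 0, pd_comm 2 0, pd_comm 2 1]
  all_goals abel

lemma pDivDiv_pSymCurl (u : PMat) : pDivDiv (pSymCurl u) = 0 := by
  simp only [pDivDiv_apply, Fin.sum_univ_three, pSymCurl_apply, pCurlVec_zero, pCurlVec_one,
    pCurlVec_two, map_add, map_sub, map_smul, pd_comm 1 0, pd_comm 2 0, pd_comm 2 1]
  module

/-! ### Degrees along the complex -/

/-- The degree in the variable `X l` allowed for the component `vᵢ` of a field in `V`. Here and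
below `m` stands for `k - 2`, which avoids truncated subtraction. -/
def degV (m : ℕ) (i l : Fin 3) : ℕ := m + 1 + if l = i then 1 else 0

/-- The degree in the variable `X l` allowed for the entry `uᵢⱼ` of a field in `𝒰`. For `i ≠ j`
it is raised by one in `X i` and lowered by one in `X j`, as by `∂ⱼ` of the component `i` in `V`. -/
def degU (m : ℕ) (i j l : Fin 3) : ℕ := m + 1 + (if l = i then 1 else 0) - if l = j then 1 else 0

/-- The degree in the variable `X l` allowed for the entry `σᵢⱼ` of a field in `Σ`. -/
def degS (m : ℕ) (i j l : Fin 3) : ℕ := m + (if l = i then 1 else 0) + if l = j then 1 else 0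

lemma pDevGrad_mem {m : ℕ} {v : PVec} (hv : ∀ i, v i ∈ box (degV m i)) (i j : Fin 3) :
    pDevGrad v i j ∈ box (degU m i j) := by
  have h : ∀ i j, pd j (v i) ∈ box (degU m i j) := fun i j =>
    pd_mem_box j (fun _ => le_rfl) (hv i)
  rw [pDevGrad_apply]
  refine sub_mem (h i j) ?_
  split_ifs with hij
  · subst hij
    refine Submodule.smul_mem _ _ (sum_mem fun l _ => box_mono (fun n => ?_) (h l l))
    simp only [degU]
    split_ifs <;> omega
  · exact zero_mem _

lemma pSymCurl_mem {m : ℕ} {u : PMat} (hu : ∀ i j, u i j ∈ box (degU m i j)) (i j : Fin 3) :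
    pSymCurl u i j ∈ box (degS m i j) := by
  have h : ∀ i j, pCurlVec (u i) j ∈ box (degS m i j) := by
    intro i j
    fin_cases j
    all_goals
      refine sub_mem (pd_mem_box _ (fun l => ?_) (hu _ _)) (pd_mem_box _ (fun l => ?_) (hu _ _)) <;>
        fin_cases i <;> fin_cases l <;> simp [degU, degS]
  refine Submodule.smul_mem _ _ (add_mem (h i j) (box_mono (fun l => ?_) (h j i)))
  simp only [degS]
  omega

lemma pDivDiv_mem {m : ℕ} {σ : PMat} (hσ : ∀ i j, σ i j ∈ box (degS m i j)) :
    pDivDiv σ ∈ box fun _ => m := by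
  rw [pDivDiv_apply]
  refine sum_mem fun i _ => ?_
  rw [map_sum]
  refine sum_mem fun j _ => ?_
  refine pd_mem_box i (d := fun l => degS m i j l - if l = j then 1 else 0) (fun l => ?_)
    (pd_mem_box j (fun _ => le_rfl) (hσ i j))
  simp only [degS]
  omega

/-! ### Exactness for polynomial fields -/

/-- The kernel of `dev grad` consists of the fields `a x + b`. -/
lemma exists_of_pDevGrad_eq_zero {v : PVec} (h : pDevGrad v = 0) :
    ∃ (a : ℝ) (b : Fin 3 → ℝ), ∀ i, v i = C a * X i + C (b i) := by
  have hoff : ∀ i j, i ≠ j → pd j (v i) = 0 := fun i j hij => by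
    have := congrFun (congrFun h i) j
    rwa [pDevGrad_apply, if_neg hij, sub_zero] at this
  have hdiag : ∀ i, pd i (v i) = (1 / 3 : ℝ) • ∑ l, pd l (v l) := fun i => by
    have := congrFun (congrFun h i) i
    rw [pDevGrad_apply, if_pos rfl] at this
    exact sub_eq_zero.1 this
  -- The common value of the `∂ᵢ vᵢ` is constant: `∂ⱼ` of it is `∂ᵢ ∂ⱼ vᵢ = 0` for any `i ≠ j`.
  obtain ⟨a, ha⟩ : ∃ a : ℝ, (1 / 3 : ℝ) • ∑ l, pd l (v l) = C a := by
    refine eq_C_of_pd_eq_zero fun j => ?_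
    obtain ⟨i, hij⟩ := exists_ne j
    rw [← hdiag i, pd_comm, hoff i j hij, map_zero]
  have hb : ∀ i, ∃ b : ℝ, v i - C a * X i = C b := fun i => by
    refine eq_C_of_pd_eq_zero fun j => ?_
    by_cases hij : i = j
    · subst hij
      rw [map_sub, hdiag, ha, pd_apply, pderiv_C_mul, pderiv_X_self, mul_one, sub_self]
    · rw [map_sub, hoff i j hij, pd_apply, pderiv_C_mul, pderiv_X_of_ne hij, mul_zero, sub_zero]
  choose b hb using hb
  exact ⟨a, b, fun i => by rw [← hb i]; ring⟩

/-- The fields `a x + b` lie in `V` and in the kernel of `dev grad`. -/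
lemma affine_mem_and_pDevGrad_eq_zero (m : ℕ) (a : ℝ) (b : Fin 3 → ℝ) :
    (∀ i, C a * X i + C (b i) ∈ box (degV m i)) ∧
      pDevGrad (fun i => C a * X i + C (b i)) = 0 := by
  constructor
  · intro i
    refine add_mem ?_ (monomial_mem_box (fun l => Nat.zero_le _) _)
    rw [X, C_mul_monomial]
    refine monomial_mem_box (fun l => ?_) _
    simp only [degV, Finsupp.single_apply]
    split_ifs <;> omega
  · have h : ∀ i j, pd j (C a * X i + C (b i)) = if i = j then C a else 0 := by
      intro i j
      rw [map_add, pd_apply, pd_apply, pderiv_C, pderiv_C_mul, pderiv_X, add_zero, Pi.single_apply]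
      split_ifs <;> simp
    ext1 i j
    rw [pDevGrad_apply]
    simp only [h, Fin.sum_univ_three, if_true, Matrix.zero_apply]
    split_ifs
    · module
    · simp

/-- Three functions of two variables each with sum zero are differences of functions of one
variable. -/
lemma exists_separated {a b c : Poly} (ha : pd 2 a = 0) (hb : pd 1 b = 0) (hc : pd 0 c = 0)
    (hsum : a + b + c = 0) :
    ∃ f : PVec, (∀ d, a ∈ box d → b ∈ box d → c ∈ box d → ∀ i, f i ∈ box d) ∧
      (∀ i j, i ≠ j → pd j (f i) = 0) ∧ f 0 - f 1 = a ∧ f 2 - f 0 = b ∧ f 1 - f 2 = c := by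
  have h2 : a + restr 2 b + restr 2 c = 0 := by
    have := congrArg (restr 2) hsum
    rwa [map_add, map_add, restr_eq_self ha, map_zero] at this
  -- Setting first `X 2 = 0` and then `X 1 = 0` in the relation separates the variables.
  have h1 : b - restr 2 b + restr 1 c - restr 1 (restr 2 c) = 0 := by
    have h3 := congrArg (restr 1) (congrArg₂ (· - ·) hsum h2)
    have e1 : restr 1 b = b := restr_eq_self hb
    have e2 : restr 1 (restr 2 b) = restr 2 b :=
      restr_eq_self (by rw [pd_restr_of_ne (by decide), hb, map_zero])
    simp only [map_add, map_sub, map_zero, e1, e2, sub_zero] at h3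
    linear_combination h3
  refine ⟨![-restr 2 b, restr 2 c, restr 1 (restr 2 c) - restr 1 c], ?_, ?_, ?_, ?_, ?_⟩
  · intro d _ h4 h5 i
    fin_cases i
    · exact neg_mem (restr_mem_box 2 h4)
    · exact restr_mem_box 2 h5
    · exact sub_mem (restr_mem_box 1 (restr_mem_box 2 h5)) (restr_mem_box 1 h5)
  · intro i j hij
    fin_cases i <;> fin_cases j <;>
      simp [pd_restr_self, pd_restr_of_ne, hb, hc] at hij ⊢
  · simp only [Matrix.cons_val]
    linear_combination -h2
  · simp only [Matrix.cons_val]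
    linear_combination -h1
  · simp only [Matrix.cons_val]
    linear_combination h1 - hsum + h2

/-- The kernel of `sym curl` is the range of `dev grad`. The off-diagonal entries of each row
determine one component of the potential up to a function of one variable, and the diagonal
determines the latter. -/
lemma exists_pDevGrad_eq {m : ℕ} {u : PMat} (htr : u.trace = 0)
    (hu : ∀ i j, u i j ∈ box (degU m i j)) (h : pSymCurl u = 0) :
    ∃ v : PVec, (∀ i, v i ∈ box (degV m i)) ∧ pDevGrad v = u := by
  have h' : ∀ i j, pCurlVec (u i) j + pCurlVec (u j) i = 0 := fun i j => by
    have := congrFun (congrFun h i) j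
    rw [pSymCurl_apply] at this
    exact (smul_eq_zero.1 this).resolve_left (by norm_num)
  have hd : ∀ i, pCurlVec (u i) i = 0 := fun i => add_self_eq_zero.1 (h' i i)
  obtain ⟨g01, g02⟩ := pd_potential (i := 1) (j := 2) (by decide) (p := u 0 1) (q := u 0 2)
    (sub_eq_zero.1 (hd 0)).symm
  obtain ⟨g12, g10⟩ := pd_potential (i := 2) (j := 0) (by decide) (p := u 1 2) (q := u 1 0)
    (sub_eq_zero.1 (hd 1)).symm
  obtain ⟨g20, g21⟩ := pd_potential (i := 0) (j := 1) (by decide) (p := u 2 0) (q := u 2 1)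
    (sub_eq_zero.1 (hd 2)).symm
  have hg0 : antideriv 1 (u 0 1) + restr 1 (antideriv 2 (u 0 2)) ∈ box (degV m 0) := by
    refine add_mem (antideriv_mem_box 1 (fun l => ?_) (hu 0 1))
      (restr_mem_box 1 (antideriv_mem_box 2 (fun l => ?_) (hu 0 2))) <;>
    fin_cases l <;> simp [degU, degV]
  have hg1 : antideriv 2 (u 1 2) + restr 2 (antideriv 0 (u 1 0)) ∈ box (degV m 1) := by
    refine add_mem (antideriv_mem_box 2 (fun l => ?_) (hu 1 2))
      (restr_mem_box 2 (antideriv_mem_box 0 (fun l => ?_) (hu 1 0))) <;>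
    fin_cases l <;> simp [degU, degV]
  have hg2 : antideriv 0 (u 2 0) + restr 0 (antideriv 1 (u 2 1)) ∈ box (degV m 2) := by
    refine add_mem (antideriv_mem_box 0 (fun l => ?_) (hu 2 0))
      (restr_mem_box 0 (antideriv_mem_box 1 (fun l => ?_) (hu 2 1))) <;>
    fin_cases l <;> simp [degU, degV]
  generalize antideriv 1 (u 0 1) + restr 1 (antideriv 2 (u 0 2)) = g0 at *
  generalize antideriv 2 (u 1 2) + restr 2 (antideriv 0 (u 1 0)) = g1 at *
  generalize antideriv 0 (u 2 0) + restr 0 (antideriv 1 (u 2 1)) = g2 at *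
  have h01 := h' 0 1
  have h02 := h' 0 2
  have h12 := h' 1 2
  simp only [pCurlVec_zero, pCurlVec_one, pCurlVec_two] at h01 h02 h12
  rw [← g02, ← g12] at h01
  rw [← g01, ← g21] at h02
  rw [← g10, ← g20] at h12
  obtain ⟨f, hfd, hf, hfa, hfb, hfc⟩ := exists_separated
    (a := (u 0 0 - pd 0 g0) - (u 1 1 - pd 1 g1)) (b := (u 2 2 - pd 2 g2) - (u 0 0 - pd 0 g0))
    (c := (u 1 1 - pd 1 g1) - (u 2 2 - pd 2 g2))
    (by simp only [map_sub]; rw [pd_comm 2 0, pd_comm 2 1]; linear_combination h01)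
    (by simp only [map_sub]; rw [pd_comm 1 0, pd_comm 1 2]; linear_combination h02)
    (by simp only [map_sub]; rw [pd_comm 0 1, pd_comm 0 2]; linear_combination h12)
    (by ring)
  have hw : ∀ i (g : Poly), g ∈ box (degV m i) → u i i - pd i g ∈ box fun _ => m + 1 := by
    intro i g hg
    refine sub_mem (box_mono (fun l => ?_) (hu i i)) (pd_mem_box i (fun l => ?_) hg)
    · simp only [degU]
      omega
    · simp only [degV]
      omega
  have hfd' := hfd (fun _ => m + 1) (sub_mem (hw 0 g0 hg0) (hw 1 g1 hg1))
    (sub_mem (hw 2 g2 hg2) (hw 0 g0 hg0)) (sub_mem (hw 1 g1 hg1) (hw 2 g2 hg2))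
  refine ⟨fun i => ![g0, g1, g2] i + antideriv i (f i), fun i => ?_, ?_⟩
  · refine add_mem ?_ (antideriv_mem_box i (fun l => le_rfl) (hfd' i))
    fin_cases i
    exacts [hg0, hg1, hg2]
  · have hdiag : ∀ i, pd i (![g0, g1, g2] i + antideriv i (f i)) = pd i (![g0, g1, g2] i) + f i :=
      fun i => by rw [map_add, pd_antideriv_self]
    have hoff : ∀ i j, i ≠ j →
        pd j (![g0, g1, g2] i + antideriv i (f i)) = pd j (![g0, g1, g2] i) := fun i j hij => by
      rw [map_add, pd_antideriv_of_ne hij.symm, hf i j hij, map_zero, add_zero]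
    have htr' : u 0 0 + u 1 1 + u 2 2 = 0 := by
      rw [← htr, Matrix.trace, Fin.sum_univ_three]
      rfl
    ext1 i j
    rw [pDevGrad_apply]
    by_cases hij : i = j
    · subst hij
      rw [if_pos rfl, Fin.sum_univ_three]
      simp only [hdiag]
      fin_cases i <;> simp only [Fin.zero_eta, Fin.mk_one, Fin.reduceFinMk, Matrix.cons_val]
      · linear_combination (norm := module) (1 / 3 : ℝ) • hfa - (1 / 3 : ℝ) • hfb -
          (1 / 3 : ℝ) • htr'
      · linear_combination (norm := module) (1 / 3 : ℝ) • hfc - (1 / 3 : ℝ) • hfa -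
          (1 / 3 : ℝ) • htr'
      · linear_combination (norm := module) (1 / 3 : ℝ) • hfb - (1 / 3 : ℝ) • hfc -
          (1 / 3 : ℝ) • htr'
    · rw [if_neg hij, sub_zero, hoff i j hij]
      fin_cases i <;> fin_cases j <;> first | exact absurd rfl hij | assumption

/-- If `∂₀ ∂₁ ∂₂ (a + b + c) = 0`, subtracting from `a`, `b`, `c` functions that do not depend on
`X 2`, `X 1`, `X 0` respectively makes the sum vanish. -/
lemma exists_sum_eq_zero {a b c : Poly} (h : pd 0 (pd 1 (pd 2 (a + b + c))) = 0) :
    ∃ a' b' c' : Poly, a' + b' + c' = 0 ∧ pd 2 a' = pd 2 a ∧ pd 1 b' = pd 1 b ∧ pd 0 c' = pd 0 c ∧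
      ∀ d, a ∈ box d → b ∈ box d → c ∈ box d → a' ∈ box d ∧ b' ∈ box d ∧ c' ∈ box d := by
  generalize hF : a + b + c = F at h
  refine ⟨a - restr 2 F, b - restr 1 (F - restr 2 F),
    c - (F - restr 2 F - restr 1 (F - restr 2 F)), ?_, ?_, ?_, ?_, ?_⟩
  · rw [← hF]
    ring
  · rw [map_sub, pd_restr_self, sub_zero]
  · rw [map_sub, pd_restr_self, sub_zero]
  · have : F - restr 2 F - restr 1 (F - restr 2 F)
        = antideriv 1 (pd 1 (antideriv 2 (pd 2 F))) := by
      simp [restr_apply]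
    rw [map_sub, this, pd_antideriv_of_ne (by decide), pd_antideriv_of_ne (by decide),
      pd_antideriv_of_ne (by decide), h, map_zero, map_zero, sub_zero]
  · intro d ha hb hc
    have h0 : F ∈ box d := hF ▸ add_mem (add_mem ha hb) hc
    have h2 := restr_mem_box 2 h0
    have h1 := restr_mem_box 1 (sub_mem h0 h2)
    exact ⟨sub_mem ha h2, sub_mem hb h1, sub_mem hc (sub_mem (sub_mem h0 h2) h1)⟩

/-- The kernel of `div div` is the range of `sym curl`. Three off-diagonal entries of the potential
produce the diagonal of `σ`; what remains is produced by a diagonal potential, whose trace can be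
made zero because of `div div σ = 0`. -/
lemma exists_pSymCurl_eq {m : ℕ} {σ : PMat} (hsymm : σ.IsSymm)
    (hσ : ∀ i j, σ i j ∈ box (degS m i j)) (h : pDivDiv σ = 0) :
    ∃ u : PMat, u.trace = 0 ∧ (∀ i j, u i j ∈ box (degU m i j)) ∧ pSymCurl u = σ := by
  have hu02 : antideriv 1 (σ 0 0) ∈ box (degU m 0 2) :=
    antideriv_mem_box 1 (fun l => by fin_cases l <;> simp [degS, degU]) (hσ 0 0)
  have hu10 : antideriv 2 (σ 1 1) ∈ box (degU m 1 0) :=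
    antideriv_mem_box 2 (fun l => by fin_cases l <;> simp [degS, degU]) (hσ 1 1)
  have hu21 : antideriv 0 (σ 2 2) ∈ box (degU m 2 1) :=
    antideriv_mem_box 0 (fun l => by fin_cases l <;> simp [degS, degU]) (hσ 2 2)
  have s10 : σ 1 0 = σ 0 1 := hsymm.apply 0 1
  have s20 : σ 2 0 = σ 0 2 := hsymm.apply 0 2
  have s21 : σ 2 1 = σ 1 2 := hsymm.apply 1 2
  have ha : antideriv 2 (2 • σ 0 1 + pd 0 (antideriv 1 (σ 0 0))) ∈ box fun _ => m + 1 := by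
    refine antideriv_mem_box 2 (d := degS m 0 1) (fun l => ?_)
      (add_mem (nsmul_mem (hσ 0 1) 2) (pd_mem_box 0 (fun l => ?_) hu02)) <;>
    fin_cases l <;> simp [degS, degU]
  have hb : antideriv 1 (2 • σ 0 2 + pd 2 (antideriv 0 (σ 2 2))) ∈ box fun _ => m + 1 := by
    refine antideriv_mem_box 1 (d := degS m 0 2) (fun l => ?_)
      (add_mem (nsmul_mem (hσ 0 2) 2) (pd_mem_box 2 (fun l => ?_) hu21)) <;>
    fin_cases l <;> simp [degS, degU]
  have hc : antideriv 0 (2 • σ 1 2 + pd 1 (antideriv 2 (σ 1 1))) ∈ box fun _ => m + 1 := by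
    refine antideriv_mem_box 0 (d := degS m 1 2) (fun l => ?_)
      (add_mem (nsmul_mem (hσ 1 2) 2) (pd_mem_box 1 (fun l => ?_) hu10)) <;>
    fin_cases l <;> simp [degS, degU]
  have hF : pd 0 (pd 1 (pd 2 (antideriv 2 (2 • σ 0 1 + pd 0 (antideriv 1 (σ 0 0)))
      + antideriv 1 (2 • σ 0 2 + pd 2 (antideriv 0 (σ 2 2)))
      + antideriv 0 (2 • σ 1 2 + pd 1 (antideriv 2 (σ 1 1)))))) = 0 := by
    have e0 : ∀ p, pd 0 (pd 1 (pd 2 (antideriv 0 p))) = pd 1 (pd 2 p) := fun p => by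
      rw [pd_comm 0 1, pd_comm 0 2, pd_antideriv_self]
    have e1 : ∀ p, pd 1 (pd 2 (antideriv 1 p)) = pd 2 p := fun p => by
      rw [pd_comm, pd_antideriv_self]
    have e00 : ∀ p, pd 0 (pd 1 (pd 0 (antideriv 1 p))) = pd 0 (pd 0 p) := fun p => by
      rw [pd_comm 1 0, pd_antideriv_self]
    have e11 : ∀ p, pd 1 (pd 2 (pd 1 (antideriv 2 p))) = pd 1 (pd 1 p) := fun p => by
      rw [pd_comm 2 1, pd_antideriv_self]
    have e22 : ∀ p, pd 0 (pd 2 (pd 2 (antideriv 0 p))) = pd 2 (pd 2 p) := fun p => by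
      rw [pd_comm 0 2, pd_comm 0 2, pd_antideriv_self]
    rw [pDivDiv_apply] at h
    simp only [Fin.sum_univ_three, map_add, s10, s20, s21, pd_comm 1 0, pd_comm 2 0,
      pd_comm 2 1] at h
    simp only [map_add, pd_antideriv_self, e0, e1, e00, e11, e22, map_nsmul]
    linear_combination h
  obtain ⟨a, b, c, hsum, hpa, hpb, hpc, hmem⟩ := exists_sum_eq_zero hF
  obtain ⟨ha', hb', hc'⟩ := hmem _ ha hb hc
  rw [pd_antideriv_self] at hpa hpb hpc
  -- The diagonal entries solve `u₀₀ - u₁₁ = a`, `u₂₂ - u₀₀ = b`, `u₁₁ - u₂₂ = c` with trace zero.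
  refine ⟨!![(1 / 3 : ℝ) • (a - b), 0, antideriv 1 (σ 0 0);
    antideriv 2 (σ 1 1), (1 / 3 : ℝ) • (c - a), 0;
    0, antideriv 0 (σ 2 2), (1 / 3 : ℝ) • (b - c)], ?_, ?_, ?_⟩
  · simp only [Matrix.trace_fin_three, Matrix.of_apply, Matrix.cons_val]
    module
  · have hdeg : ∀ (i : Fin 3) (p : Poly), p ∈ box (fun _ => m + 1) →
        (1 / 3 : ℝ) • p ∈ box (degU m i i) := fun i p hp =>
      Submodule.smul_mem _ _ (box_mono (fun l => by simp only [degU]; omega) hp)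
    intro i j
    fin_cases i <;> fin_cases j
    exacts [hdeg 0 _ (sub_mem ha' hb'), zero_mem _, hu02, hu10, hdeg 1 _ (sub_mem hc' ha'),
      zero_mem _, zero_mem _, hu21, hdeg 2 _ (sub_mem hb' hc')]
  · have hca : c = -a - b := by linear_combination hsum
    subst hca
    rw [map_sub, map_neg] at hpc
    ext1 i j
    rw [pSymCurl_apply]
    fin_cases i <;> fin_cases j <;>
      simp only [Fin.zero_eta, Fin.mk_one, Fin.reduceFinMk, pCurlVec_zero, pCurlVec_one,
        pCurlVec_two, Matrix.of_apply, Matrix.cons_val, s10, s20, s21, map_smul, map_sub, map_neg,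
        map_zero, hpa, hpb, pd_antideriv_self]
    all_goals first | module | linear_combination (norm := module) (1 / 2 : ℝ) • hpc

/-- The operator `div div` is onto: integrate twice in one variable. -/
lemma exists_pDivDiv_eq {m : ℕ} {q : Poly} (hq : q ∈ box fun _ => m) :
    ∃ σ : PMat, σ.IsSymm ∧ (∀ i j, σ i j ∈ box (degS m i j)) ∧ pDivDiv σ = q := by
  refine ⟨Matrix.single 0 0 (antideriv 0 (antideriv 0 q)), ?_, ?_, ?_⟩
  · ext1 i j
    fin_cases i <;> fin_cases j <;> simp [Matrix.single]
  · intro i j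
    by_cases h : 0 = i ∧ 0 = j
    · obtain ⟨rfl, rfl⟩ := h
      rw [Matrix.single_apply_same]
      refine antideriv_mem_box 0 (d := fun l => m + if l = 0 then 1 else 0) (fun l => ?_)
        (antideriv_mem_box 0 (fun _ => le_rfl) hq)
      simp only [degS]
      omega
    · rw [Matrix.single_apply_of_ne _ _ _ _ _ h]
      exact zero_mem _
  · simp [pDivDiv_apply, Fin.sum_univ_three, Matrix.single]

/-! ### The function spaces as images of polynomial fields -/

variable (D)

/-- A polynomial vector field as a vector field on `D`. -/
def evVec : PVec →ₗ[ℝ] (D → Fin 3 → ℝ) where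
  toFun p := fun x i => ev D (p i) x
  map_add' p q := by ext x i; simp
  map_smul' c p := by ext x i; simp

/-- A polynomial matrix field as a matrix field on `D`. -/
def evMat : PMat →ₗ[ℝ] (D → Mat3) where
  toFun p := fun x => Matrix.of fun i j => ev D (p i j) x
  map_add' p q := by ext x i j; simp
  map_smul' c p := by ext x i j; simp

lemma evVec_apply (p : PVec) (x : D) (i : Fin 3) : evVec D p x i = ev D (p i) x := rfl

lemma evMat_apply (p : PMat) (x : D) (i j : Fin 3) : evMat D p x i j = ev D (p i j) x := rfl

variable {D}

lemma evMat_injective (hD : (D : Set E3).Nonempty) : Function.Injective (evMat D) := by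
  intro p q h
  ext1 i j
  refine ev_injective hD (funext fun x => ?_)
  rw [← evMat_apply, h, evMat_apply]

lemma partialD_evVec (i j : Fin 3) (p : PVec) :
    partialD D j (fun y => evVec D p y i) = ev D (pd j (p i)) :=
  partialD_ev j (p i)

lemma devGrad_evVec (p : PVec) : devGrad D (evVec D p) = evMat D (pDevGrad p) := by
  ext x i j
  simp only [devGrad, devPart, grad, partialD_evVec, Matrix.trace, Matrix.diag_apply,
    Matrix.of_apply, Matrix.sub_apply, Matrix.smul_apply, Matrix.one_apply, evMat_apply,
    pDevGrad_apply]
  split_ifs <;> simp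

lemma curlVec_evVec (p : PVec) : curlVec D (evVec D p) = evVec D (pCurlVec p) := by
  ext x i
  simp only [curlVec, partialD_evVec]
  fin_cases i <;> simp [evVec_apply, pCurlVec_zero, pCurlVec_one, pCurlVec_two]

lemma symCurl_evMat (p : PMat) : symCurl D (evMat D p) = evMat D (pSymCurl p) := by
  ext x i j
  have h : ∀ i, curlVec D (fun y => evMat D p y i) = evVec D (pCurlVec (p i)) := fun i =>
    curlVec_evVec (p i)
  simp [symCurl, symPart, curl, h, evMat_apply, evVec_apply, pSymCurl_apply, mul_add]

lemma divVec_evVec (p : PVec) : divVec D (evVec D p) = ev D (∑ i, pd i (p i)) := by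
  ext x
  simp [divVec, partialD_evVec]

lemma divDiv_evMat (p : PMat) : divDiv D (evMat D p) = ev D (pDivDiv p) := by
  have h : div D (evMat D p) = evVec D fun i => ∑ j, pd j (p i j) := by
    ext x i
    exact congrFun (divVec_evVec (p i)) x
  rw [divDiv, h, divVec_evVec, pDivDiv_apply]

lemma mem_VSpace_iff {m : ℕ} {v : D → Fin 3 → ℝ} :
    v ∈ VSpace D (m + 2) ↔ ∃ p : PVec, (∀ i, p i ∈ box (degV m i)) ∧ evVec D p = v := by
  have h : v ∈ VSpace D (m + 2) ↔
      ∀ i, (fun x => v x i) ∈ polyP D (degV m i 0) (degV m i 1) (degV m i 2) := by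
    simp [VSpace, prodSpace, degV, Fin.forall_fin_succ]
  rw [h]
  constructor
  · intro hv
    choose p hp hpv using fun i => mem_polyP_iff.1 (hv i)
    exact ⟨p, hp, funext fun x => funext fun i => congrFun (hpv i) x⟩
  · rintro ⟨p, hp, rfl⟩ i
    exact mem_polyP_iff.2 ⟨p i, hp i, rfl⟩

lemma mem_USpace_iff (hD : (D : Set E3).Nonempty) (hbdd : Bornology.IsBounded (D : Set E3))
    {m : ℕ} {u : D → Mat3} :
    u ∈ USpace D (m + 2) ↔
      ∃ p : PMat, p.trace = 0 ∧ (∀ i j, p i j ∈ box (degU m i j)) ∧ evMat D p = u := by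
  have h : u ∈ USpace D (m + 2) ↔ u ∈ H1Traceless D ∧
      ∀ i j, (fun x => u x i j) ∈ polyP D (degU m i j 0) (degU m i j 1) (degU m i j 2) := by
    simp [USpace, prodSpace, polyQ, degU, Fin.forall_fin_succ, normalPart, shearPart,
      transposeField]
    tauto
  rw [h]
  constructor
  · rintro ⟨⟨-, htr⟩, hu⟩
    choose p hp hpu using fun i j => mem_polyP_iff.1 (hu i j)
    refine ⟨Matrix.of p, ev_injective hD (funext fun x => ?_), hp,
      funext fun x => Matrix.ext fun i j => congrFun (hpu i j) x⟩
    have := htr x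
    simp only [Matrix.trace_fin_three, ← congrFun (hpu _ _) x] at this
    simpa [Matrix.trace_fin_three] using this
  · rintro ⟨p, htr, hp, rfl⟩
    refine ⟨⟨fun i j => memH1_ev hbdd (p i j), fun x => ?_⟩,
      fun i j => mem_polyP_iff.2 ⟨p i j, hp i j, rfl⟩⟩
    have := congrFun (congrArg (ev D) htr) x
    simpa [Matrix.trace_fin_three, evMat_apply] using this

lemma mem_SigmaSpace_iff (hD : (D : Set E3).Nonempty) (hbdd : Bornology.IsBounded (D : Set E3))
    {m : ℕ} {σ : D → Mat3} :
    σ ∈ SigmaSpace D (m + 2) ↔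
      ∃ p : PMat, p.IsSymm ∧ (∀ i j, p i j ∈ box (degS m i j)) ∧ evMat D p = σ := by
  have h : σ ∈ SigmaSpace D (m + 2) ↔ σ ∈ H1Sym D ∧
      ∀ i j, (fun x => σ x i j) ∈ polyP D (degS m i j 0) (degS m i j 1) (degS m i j 2) := by
    have hs : σ ∈ H1Sym D → ∀ i j, (fun x => σ x i j) = fun x => σ x j i := fun hσ i j =>
      funext fun x => (hσ.2 x).apply j i
    simp only [SigmaSpace, prodSpace, degS, Fin.forall_fin_succ, normalPart, shearPart,
      Submodule.mem_inf, and_assoc]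
    refine and_congr_right fun hσ => ?_
    simp [hs hσ 1 0, hs hσ 2 0, hs hσ 2 1]
    tauto
  rw [h]
  constructor
  · rintro ⟨⟨-, hsymm⟩, hσ⟩
    choose p hp hpσ using fun i j => mem_polyP_iff.1 (hσ i j)
    refine ⟨Matrix.of p, Matrix.ext fun i j => ev_injective hD (funext fun x => ?_), hp,
      funext fun x => Matrix.ext fun i j => congrFun (hpσ i j) x⟩
    rw [Matrix.transpose_apply, Matrix.of_apply, Matrix.of_apply, hpσ, hpσ]
    exact (hsymm x).apply i j
  · rintro ⟨p, hsymm, hp, rfl⟩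
    refine ⟨⟨fun i j => memH1_ev hbdd (p i j), fun x => Matrix.ext fun i j => ?_⟩,
      fun i j => mem_polyP_iff.2 ⟨p i j, hp i j, rfl⟩⟩
    rw [Matrix.transpose_apply, evMat_apply, evMat_apply, hsymm.apply]

lemma mem_polyQ_iff {m : ℕ} {q : D → ℝ} :
    q ∈ polyQ D m ↔ ∃ p ∈ box fun _ => m, ev D p = q :=
  mem_polyP_iff (d := fun _ => m)

lemma RT_le_VSpace (m : ℕ) : RT D ≤ VSpace D (m + 2) := by
  rintro _ ⟨a, b, rfl⟩
  refine mem_VSpace_iff.2 ⟨fun i => C a * X i + C (b i),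
    (affine_mem_and_pDevGrad_eq_zero m a b).1, ?_⟩
  ext x i
  simp [evVec_apply, ev_apply]

/-- An operator `T` that acts on the images of `eA`, `eB` through a linear map `L` is linear between
subspaces of these images. -/
lemma exists_linearMap {A B X Y : Type*} [AddCommGroup A] [Module ℝ A] [AddCommGroup B]
    [Module ℝ B] [AddCommGroup X] [Module ℝ X] [AddCommGroup Y] [Module ℝ Y] (eA : A →ₗ[ℝ] X)
    (eB : B →ₗ[ℝ] Y) (L : A →ₗ[ℝ] B) (T : X → Y) (hT : ∀ a, T (eA a) = eB (L a))
    (S : Submodule ℝ X) (R : Submodule ℝ Y) (hS : ∀ s ∈ S, ∃ a, eA a = s)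
    (hR : ∀ s ∈ S, T s ∈ R) : ∃ d : S →ₗ[ℝ] R, ∀ s, (d s : Y) = T s := by
  refine ⟨{ toFun := fun s => ⟨T s, hR s s.2⟩, map_add' := ?_, map_smul' := ?_ }, fun s => rfl⟩
  · rintro ⟨s, hs⟩ ⟨t, ht⟩
    obtain ⟨a, rfl⟩ := hS s hs
    obtain ⟨b, rfl⟩ := hS t ht
    refine Subtype.ext ?_
    change T (eA a + eA b) = T (eA a) + T (eA b)
    rw [← map_add, hT, hT, hT, map_add, map_add]
  · rintro c ⟨s, hs⟩
    obtain ⟨a, rfl⟩ := hS s hs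
    refine Subtype.ext ?_
    change T (c • eA a) = c • T (eA a)
    rw [← map_smul, hT, hT, map_smul, map_smul]

end DivDiv

end

open DivDiv in
/-- On a bounded domain `D` of `ℝ³` and for `k ≥ 2`, the operators `dev grad`, `sym curl`, `div div`
define linear maps between the polynomial spaces, and the resulting sequence
`RT ⊆ V_{[k]} → 𝒰_{[k]} → Σ_{[k]} → Q_{k-2} → 0` is exact at each place. -/
theorem mainTheorem3 (D : TopologicalSpace.Opens DivDiv.E3)
    (hconn : IsConnected (D : Set DivDiv.E3))
    (hbdd : Bornology.IsBounded (D : Set DivDiv.E3)) (k : ℕ) (hk : 2 ≤ k) :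
    ∃ (d₀ : DivDiv.VSpace D k →ₗ[ℝ] DivDiv.USpace D k)
      (d₁ : DivDiv.USpace D k →ₗ[ℝ] DivDiv.SigmaSpace D k)
      (d₂ : DivDiv.SigmaSpace D k →ₗ[ℝ] DivDiv.polyQ D (k - 2)),
      (∀ v, (d₀ v : D → DivDiv.Mat3) = DivDiv.devGrad D v) ∧
      (∀ u, (d₁ u : D → DivDiv.Mat3) = DivDiv.symCurl D u) ∧
      (∀ σ, (d₂ σ : D → ℝ) = DivDiv.divDiv D σ) ∧
      ∃ hRT : DivDiv.RT D ≤ DivDiv.VSpace D k,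
        Function.Exact (Submodule.inclusion hRT) d₀ ∧
        Function.Exact d₀ d₁ ∧
        Function.Exact d₁ d₂ ∧
        Function.Surjective d₂ := by
  obtain ⟨m, rfl⟩ := Nat.exists_eq_add_of_le' hk
  rw [Nat.add_sub_cancel]
  have hD := hconn.nonempty
  obtain ⟨d₀, h₀⟩ := exists_linearMap (evVec D) (evMat D) pDevGrad (devGrad D) devGrad_evVec
    (VSpace D (m + 2)) (USpace D (m + 2))
    (fun v hv => (mem_VSpace_iff.1 hv).imp fun _ h => h.2) (fun v hv => by
      obtain ⟨p, hp, rfl⟩ := mem_VSpace_iff.1 hv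
      exact (mem_USpace_iff hD hbdd).2
        ⟨pDevGrad p, trace_pDevGrad p, pDevGrad_mem hp, (devGrad_evVec p).symm⟩)
  obtain ⟨d₁, h₁⟩ := exists_linearMap (evMat D) (evMat D) pSymCurl (symCurl D) symCurl_evMat
    (USpace D (m + 2)) (SigmaSpace D (m + 2))
    (fun u hu => ((mem_USpace_iff hD hbdd).1 hu).imp fun _ h => h.2.2) (fun u hu => by
      obtain ⟨p, -, hp, rfl⟩ := (mem_USpace_iff hD hbdd).1 hu
      exact (mem_SigmaSpace_iff hD hbdd).2
        ⟨pSymCurl p, isSymm_pSymCurl p, pSymCurl_mem hp, (symCurl_evMat p).symm⟩)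
  obtain ⟨d₂, h₂⟩ := exists_linearMap (evMat D) (ev D) pDivDiv (divDiv D) divDiv_evMat
    (SigmaSpace D (m + 2)) (polyQ D m)
    (fun σ hσ => ((mem_SigmaSpace_iff hD hbdd).1 hσ).imp fun _ h => h.2.2) (fun σ hσ => by
      obtain ⟨p, -, hp, rfl⟩ := (mem_SigmaSpace_iff hD hbdd).1 hσ
      exact mem_polyQ_iff.2 ⟨pDivDiv p, pDivDiv_mem hp, (divDiv_evMat p).symm⟩)
  refine ⟨d₀, d₁, d₂, h₀, h₁, h₂, RT_le_VSpace m, ?_, ?_, ?_, ?_⟩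
  · rintro ⟨v, hv⟩
    obtain ⟨p, hp, rfl⟩ := mem_VSpace_iff.1 hv
    rw [Subtype.ext_iff, h₀]
    constructor
    · intro h
      have hp0 : pDevGrad p = 0 := evMat_injective hD (by
        rw [← devGrad_evVec, map_zero]
        exact h)
      obtain ⟨a, b, hab⟩ := exists_of_pDevGrad_eq_zero hp0
      refine ⟨⟨evVec D p, a, b, ?_⟩, rfl⟩
      ext x i
      simp [evVec_apply, ev_apply, hab]
    · rintro ⟨⟨_, a, b, rfl⟩, h⟩
      have h' : evVec D p = evVec D fun i => MvPolynomial.C a * MvPolynomial.X i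
          + MvPolynomial.C (b i) := by
        refine (congrArg Subtype.val h).symm.trans ?_
        ext x i
        simp [evVec_apply, ev_apply]
      change devGrad D (evVec D p) = 0
      rw [h', devGrad_evVec, (affine_mem_and_pDevGrad_eq_zero m a b).2, map_zero]
  · rintro ⟨u, hu⟩
    rw [Subtype.ext_iff, h₁]
    constructor
    · intro h
      obtain ⟨p, htr, hp, rfl⟩ := (mem_USpace_iff hD hbdd).1 hu
      have hp0 : pSymCurl p = 0 := evMat_injective hD (by
        rw [← symCurl_evMat, map_zero]
        exact h)
      obtain ⟨v, hv, rfl⟩ := exists_pDevGrad_eq htr hp hp0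
      refine ⟨⟨evVec D v, mem_VSpace_iff.2 ⟨v, hv, rfl⟩⟩, Subtype.ext ?_⟩
      rw [h₀, devGrad_evVec]
    · rintro ⟨⟨v, hv⟩, h⟩
      obtain ⟨p, hp, rfl⟩ := mem_VSpace_iff.1 hv
      rw [← h, h₀, devGrad_evVec, symCurl_evMat, pSymCurl_pDevGrad, map_zero]
      rfl
  · rintro ⟨σ, hσ⟩
    rw [Subtype.ext_iff, h₂]
    constructor
    · intro h
      obtain ⟨p, hsymm, hp, rfl⟩ := (mem_SigmaSpace_iff hD hbdd).1 hσ
      have hp0 : pDivDiv p = 0 := ev_injective hD (by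
        rw [← divDiv_evMat, map_zero]
        exact h)
      obtain ⟨u, htr, hu, rfl⟩ := exists_pSymCurl_eq hsymm hp hp0
      refine ⟨⟨evMat D u, (mem_USpace_iff hD hbdd).2 ⟨u, htr, hu, rfl⟩⟩, Subtype.ext ?_⟩
      rw [h₁, symCurl_evMat]
    · rintro ⟨⟨u, hu⟩, h⟩
      obtain ⟨p, -, hp, rfl⟩ := (mem_USpace_iff hD hbdd).1 hu
      rw [← h, h₁, symCurl_evMat, divDiv_evMat, pDivDiv_pSymCurl, map_zero]
      rfl
  · rintro ⟨q, hq⟩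
    obtain ⟨p, hp, rfl⟩ := mem_polyQ_iff.1 hq
    obtain ⟨σ, hsymm, hσ, rfl⟩ := exists_pDivDiv_eq hp
    refine ⟨⟨evMat D σ, (mem_SigmaSpace_iff hD hbdd).2 ⟨σ, hsymm, hσ, rfl⟩⟩, Subtype.ext ?_⟩
    rw [h₂, divDiv_evMat]
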